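/- Proposition. Let $Z_1,Z_2,\ldots$ be independent standard real Gaussian random variables, let $a:=\mathbb{E}\log|Z_1|$, let $W_i:=\log|Z_i|-a$, and let $L_1,L_2,\ldots$ be independent symmetric exponential random variables, i.e. with density $\frac12 e^{-|t|}$ on $\mathbb{R}$. For a random variable $R$ and $p\geq 1$ write $\|R\|_p:=(\mathbb{E}|R|^p)^{1/p}$. For $x\in\mathbb{R}^n$ let $x^*_1\geq\cdots\geq x^*_n$ be the non-increasing rearrangement of $|x_1|,\ldots,|x_n|$, and for a real number $s\geq 1$ let $x^s\in\mathbb{R}^n$ be the vector whose $i$-th entry is $x^*_i$ if $i\leq s$ and $0$ otherwise, and $x_s\in\mathbb{R}^n$ the vector whose $i$-th entry is $0$ if $i\leq s$ and $x^*_i$ otherwise. Then there exist two universal constants $C_1,C_2>0$ such that for every integer $n\geq 1$, every real $p\geq 1$ and every $\theta=(\theta_1,\ldots,\theta_n)$ in the Euclidean unit sphere $S^{n-1}\subset\mathbb{R}^n$, the random variable $\langle W,\theta\rangle=\sum_{i=1}^n\theta_iW_i$ has finite $p$-th absolute moment and $$C_1\,p\,\|\theta^p\|_\infty+C_1\sqrt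 p\,\|\theta_p\|_2\ \leq\ \|\langle W,\theta\rangle\|_p\ \leq\ C_2\,p\,\|\theta^p\|_\infty+C_2\sqrt p\,\|\theta_p\|_2 .$$ The same holds, with the same constants, for $\langle L,\theta\rangle=\sum_{i=1}^n\theta_iL_i$ in place of $\langle W,\theta\rangle$. -/

import Mathlib

open MeasureTheory ProbabilityTheory

noncomputable section

/-- The non-increasing rearrangement `x^*` of `(|x₁|, …, |xₙ|)`; the entry written `x^*_i` with
`1 ≤ i ≤ n` is `decreasingRearrangement x ⟨i - 1, _⟩`. -/
def decreasingRearrangement {n : ℕ} (x : EuclideanSpace ℝ (Fin n)) : EuclideanSpace ℝ (Fin n) :=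
  WithLp.toLp 2 fun i => |x (Tuple.sort (fun j => -|x j|) i)|

theorem decreasingRearrangement_antitone {n : ℕ} (x : EuclideanSpace ℝ (Fin n)) :
    Antitone fun i => decreasingRearrangement x i := by
  intro i j hij
  have h := Tuple.monotone_sort (fun j => -|x j|) hij
  simp only [Function.comp] at h
  simp only [decreasingRearrangement]
  linarith

/-- The vector `x^s`: its `i`-th entry (counting from `1`) is `x^*_i` for `i ≤ s`, and `0`
otherwise. -/
def headPart {n : ℕ} (x : EuclideanSpace ℝ (Fin n)) (s : ℝ) : EuclideanSpace ℝ (Fin n) :=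
  open Classical in
  WithLp.toLp 2 fun i => if ((i : ℕ) : ℝ) + 1 ≤ s then decreasingRearrangement x i else 0

/-- The vector `x_s`: its `i`-th entry (counting from `1`) is `0` for `i ≤ s`, and `x^*_i`
otherwise. -/
def tailPart {n : ℕ} (x : EuclideanSpace ℝ (Fin n)) (s : ℝ) : EuclideanSpace ℝ (Fin n) :=
  open Classical in
  WithLp.toLp 2 fun i => if ((i : ℕ) : ℝ) + 1 ≤ s then 0 else decreasingRearrangement x i

/-- The sup norm `‖x‖_∞` on `ℝⁿ` (the norm of `Fin n → ℝ`). -/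
def supNorm {n : ℕ} (x : EuclideanSpace ℝ (Fin n)) : ℝ := ‖WithLp.ofLp x‖

/-- `‖R‖_p = (𝔼 |R|^p)^{1/p}`. -/
def momentNorm {Ω : Type*} [MeasurableSpace Ω] (μ : Measure Ω) (R : Ω → ℝ) (p : ℝ) : ℝ :=
  (∫ ω, |R ω| ^ p ∂μ) ^ (1 / p)

/-- `a = 𝔼 log |Z|` for a standard real Gaussian `Z`. -/
def meanLogAbsGaussian : ℝ := ∫ z, Real.log |z| ∂(gaussianReal 0 1)

/-- The law of a symmetric exponential random variable: density `e^{-|t|} / 2` on `ℝ`. -/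
def symmetricExponential : Measure ℝ :=
  volume.withDensity fun t => ENNReal.ofReal (1 / 2 * Real.exp (-|t|))

end

/-! Write `M` for the largest `|θ i|`. At most `p` entries survive in the head, so its Euclidean
norm is at most `√p * M`. As `‖θ‖ = 1`, both sides of the claim are therefore comparable to `p * M +
√p`, and the rearrangement plays no further role. Moments depend only on the law, so it is enough to
treat a product measure whose factor satisfies `HasExponentialTails`; both laws do.

Upper bound: a centred variable with an exponential moment has `mgf` at most `exp (K * l ^ 2)` near
`0`. By independence the sum satisfies the same bound as long as `|t| * M` stays small, and the best
such `t` with `t ≤ √p` gives the moment (`momentNorm_weighted_sum_le`).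

Lower bound for `p ≥ 2`: pass to an even exponent `2 * k` and symmetrise. Odd moments then vanish,
so every term in the binomial expansion of an even moment is nonnegative. Keeping one summand and
using its exponential tail yields `p * M`. Comparing the moments of each summand with Gaussian ones,
a comparison that is stable under independent sums, yields `√p` (`even_moments_sum_of_iIndepFun`,
`pow_le_integral_weighted_sum_pow`).

Lower bound for `p < 2`: the target is bounded, and the first moment is bounded below through the
second and fourth (`le_momentNorm_one`). -/

/-! ### Comparison of even moments with Gaussian moments -/

theorem sum_range_two_mul_add_one_of_odd_eq_zero {f : ℕ → ℝ} (hf : ∀ j, f (2 * j + 1) = 0)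
    (k : ℕ) : ∑ j ∈ Finset.range (2 * k + 1), f j = ∑ i ∈ Finset.range (k + 1), f (2 * i) := by
  induction k with
  | zero => simp
  | succ k ih =>
    rw [Finset.sum_range_succ _ (k + 1), ← ih, show 2 * (k + 1) + 1 = 2 * k + 1 + 1 + 1 by ring,
      Finset.sum_range_succ, Finset.sum_range_succ, hf k]
    simp [show 2 * k + 1 + 1 = 2 * (k + 1) by ring]

/-- The number `u ^ j * ((2 * j)! / j!)` is the moment of order `2 * j` of a centred Gaussian of
variance `2 * u`. The inequality reflects that variances of independent Gaussians add: with these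
moments the even terms match those of the binomial expansion of `(u + v) ^ k` exactly. -/
theorem pow_add_mul_factorial_div_le_sum {α β : ℕ → ℝ} {u v : ℝ} (hu : 0 ≤ u) (hv : 0 ≤ v)
    (hαo : ∀ j, α (2 * j + 1) = 0)
    (hα : ∀ j, u ^ j * ((2 * j).factorial / j.factorial) ≤ α (2 * j))
    (hβ : ∀ j, v ^ j * ((2 * j).factorial / j.factorial) ≤ β (2 * j)) (k : ℕ) :
    (u + v) ^ k * ((2 * k).factorial / k.factorial) ≤
      ∑ j ∈ Finset.range (2 * k + 1), ((2 * k).choose j : ℝ) * (α j * β (2 * k - j)) := by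
  rw [sum_range_two_mul_add_one_of_odd_eq_zero (by simp [hαo]), add_pow, Finset.sum_mul]
  refine Finset.sum_le_sum fun i hi => ?_
  have hik : i ≤ k := by simpa [Nat.lt_succ_iff] using hi
  have h1 := hα i
  have h2 := hβ (k - i)
  have hα0 : 0 ≤ α (2 * i) := le_trans (by positivity) h1
  rw [show 2 * k - 2 * i = 2 * (k - i) by omega]
  have h3 : ((2 * k).choose (2 * i) : ℝ) = (2 * k).factorial /
      ((2 * i).factorial * (2 * (k - i)).factorial) := by
    rw [Nat.cast_choose ℝ (by omega), show 2 * k - 2 * i = 2 * (k - i) by omega]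
  have h4 : (k.choose i : ℝ) = k.factorial / (i.factorial * (k - i).factorial) :=
    Nat.cast_choose ℝ hik
  calc u ^ i * v ^ (k - i) * (k.choose i : ℝ) * ((2 * k).factorial / k.factorial)
      = ((2 * k).choose (2 * i) : ℝ) * ((u ^ i * ((2 * i).factorial / i.factorial)) *
        (v ^ (k - i) * ((2 * (k - i)).factorial / (k - i).factorial))) := by
        rw [h3, h4]
        have := Nat.factorial_ne_zero k
        have := Nat.factorial_ne_zero i
        have := Nat.factorial_ne_zero (k - i)
        have := Nat.factorial_ne_zero (2 * i)
        have := Nat.factorial_ne_zero (2 * (k - i))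
        field_simp
    _ ≤ _ := by gcongr

section Moments

variable {Ω : Type*} [MeasurableSpace Ω] {μ : Measure Ω}

theorem integrable_pow_of_forall_memLp [IsFiniteMeasure μ] {A : Ω → ℝ}
    (hA : ∀ m : ℕ, MemLp A m μ) (m : ℕ) : Integrable (fun ω => A ω ^ m) μ := by
  have := (hA m).integrable_norm_pow'
  refine this.mono' (((hA 1).1.aemeasurable.pow_const m).aestronglyMeasurable) ?_
  exact Filter.Eventually.of_forall fun ω => by simp [norm_pow]

theorem integral_add_pow_of_indepFun [IsProbabilityMeasure μ] {A B : Ω → ℝ}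
    (hA : ∀ m : ℕ, MemLp A m μ) (hB : ∀ m : ℕ, MemLp B m μ) (hAB : IndepFun A B μ) (m : ℕ) :
    ∫ ω, (A ω + B ω) ^ m ∂μ =
      ∑ j ∈ Finset.range (m + 1),
        (m.choose j : ℝ) * ((∫ ω, A ω ^ j ∂μ) * ∫ ω, B ω ^ (m - j) ∂μ) := by
  have hind : ∀ j l : ℕ, IndepFun (fun ω => A ω ^ j) (fun ω => B ω ^ l) μ := fun j l =>
    hAB.comp (φ := fun x : ℝ => x ^ j) (ψ := fun x : ℝ => x ^ l) (by fun_prop) (by fun_prop)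
  have hint : ∀ j l : ℕ, Integrable (fun ω => A ω ^ j * B ω ^ l) μ := fun j l =>
    (hind j l).integrable_mul (integrable_pow_of_forall_memLp hA j)
      (integrable_pow_of_forall_memLp hB l)
  simp_rw [add_pow]
  rw [integral_finsetSum _ fun j _ => (hint j (m - j)).mul_const _]
  refine Finset.sum_congr rfl fun j _ => ?_
  rw [integral_mul_const, mul_comm]
  congr 1
  exact (hind j (m - j)).integral_fun_mul_eq_mul_integral
    (integrable_pow_of_forall_memLp hA j).1 (integrable_pow_of_forall_memLp hB _).1

/-- Induction on the index set. Vanishing odd moments are inherited by sums and leave only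
nonnegative terms in the expansion of an even moment. This gives both the Gaussian lower bound and
domination of each single summand. -/
theorem even_moments_sum_of_iIndepFun [IsProbabilityMeasure μ] {ι : Type*} {Y : ι → Ω → ℝ}
    (hY : iIndepFun Y μ) (hmeas : ∀ i, Measurable (Y i)) (hLp : ∀ i, ∀ m : ℕ, MemLp (Y i) m μ)
    (hodd : ∀ i j, ∫ ω, Y i ω ^ (2 * j + 1) ∂μ = 0) {v : ι → ℝ} (hv : ∀ i, 0 ≤ v i)
    (heven : ∀ i j, v i ^ j * ((2 * j).factorial / j.factorial) ≤ ∫ ω, Y i ω ^ (2 * j) ∂μ)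
    (s : Finset ι) :
    (∀ j, ∫ ω, (∑ i ∈ s, Y i ω) ^ (2 * j + 1) ∂μ = 0) ∧
    (∀ k, (∑ i ∈ s, v i) ^ k * ((2 * k).factorial / k.factorial) ≤
      ∫ ω, (∑ i ∈ s, Y i ω) ^ (2 * k) ∂μ) ∧
    ∀ i ∈ s, ∀ k, ∫ ω, Y i ω ^ (2 * k) ∂μ ≤ ∫ ω, (∑ i ∈ s, Y i ω) ^ (2 * k) ∂μ := by
  classical
  induction s using Finset.induction_on with
  | empty =>
    refine ⟨fun j => by simp, fun k => ?_, by simp⟩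
    rcases k with _ | k <;> simp
  | insert a s ha ih =>
    obtain ⟨iho, ihe, ihm⟩ := ih
    have hSLp : ∀ m : ℕ, MemLp (fun ω => ∑ i ∈ s, Y i ω) m μ := fun m =>
      memLp_finsetSum s fun i _ => hLp i m
    have hind : IndepFun (fun ω => ∑ i ∈ s, Y i ω) (Y a) μ := by
      have := hY.indepFun_finsetSum_of_notMem hmeas ha
      convert this using 1
      ext ω
      simp
    have hexp : ∀ m : ℕ, ∫ ω, (∑ i ∈ insert a s, Y i ω) ^ m ∂μ =
        ∑ j ∈ Finset.range (m + 1), (m.choose j : ℝ) *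
          ((∫ ω, (∑ i ∈ s, Y i ω) ^ j ∂μ) * ∫ ω, Y a ω ^ (m - j) ∂μ) := fun m => by
      rw [← integral_add_pow_of_indepFun hSLp (hLp a) hind m]
      simp_rw [Finset.sum_insert ha, add_comm]
    have hnn : ∀ k, ∀ j ∈ Finset.range (2 * k + 1), 0 ≤ ((2 * k).choose j : ℝ) *
          ((∫ ω, (∑ i ∈ s, Y i ω) ^ j ∂μ) * ∫ ω, Y a ω ^ (2 * k - j) ∂μ) := fun k j hj => by
      rcases Nat.even_or_odd' j with ⟨l, rfl | rfl⟩
      · have : Even (2 * k - 2 * l) := ⟨k - l, by omega⟩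
        have h1 : 0 ≤ ∫ ω, Y a ω ^ (2 * k - 2 * l) ∂μ :=
          integral_nonneg fun ω => this.pow_nonneg _
        have h2 : 0 ≤ ∫ ω, (∑ i ∈ s, Y i ω) ^ (2 * l) ∂μ :=
          integral_nonneg fun ω => (even_two_mul l).pow_nonneg _
        positivity
      · simp [iho l]
    refine ⟨fun j => ?_, fun k => ?_, fun i hi k => ?_⟩
    · rw [hexp]
      refine Finset.sum_eq_zero fun l hl => ?_
      rcases Nat.even_or_odd' l with ⟨r, rfl | rfl⟩
      · rw [show 2 * j + 1 - 2 * r = 2 * (j - r) + 1 by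
          have := Finset.mem_range.1 hl; omega, hodd]
        simp
      · simp [iho]
    · rw [hexp, Finset.sum_insert ha, add_comm]
      exact pow_add_mul_factorial_div_le_sum (β := fun j => ∫ ω, Y a ω ^ j ∂μ)
        (Finset.sum_nonneg fun i _ => hv i) (hv a) iho ihe (heven a) k
    · rw [hexp]
      -- The terms of index `0` and `2 * k` are the even moments of the new summand and of the old
      -- sum.
      rcases Finset.mem_insert.1 hi with rfl | hi
      · have := Finset.single_le_sum (hnn k) (Finset.mem_range.2 (show 0 < 2 * k + 1 by omega))
        simpa using this
      · have := Finset.single_le_sum (hnn k)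
          (Finset.mem_range.2 (show 2 * k < 2 * k + 1 by omega))
        refine (ihm i hi k).trans ?_
        simpa using this

end Moments

/-! ### Upper bound through exponential moments -/

theorem exp_le_one_add_add_sq_mul_exp_abs (u : ℝ) :
    Real.exp u ≤ 1 + u + u ^ 2 * Real.exp |u| := by
  have h1 : 1 ≤ Real.exp |u| := Real.one_le_exp (abs_nonneg u)
  have h2 : u ^ 2 ≤ u ^ 2 * Real.exp |u| := le_mul_of_one_le_right (sq_nonneg u) h1
  rcases le_or_gt |u| 1 with hu | hu
  · have := Real.norm_exp_sub_one_sub_id_le (x := u) (by simpa using hu)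
    rw [Real.norm_eq_abs, Real.norm_eq_abs, sq_abs] at this
    linarith [le_abs_self (Real.exp u - 1 - u)]
  · rcases lt_abs.1 hu with hu | hu
    · rw [abs_of_pos (by linarith)] at h1 ⊢
      nlinarith [mul_le_mul_of_nonneg_right (show 1 ≤ u ^ 2 by nlinarith) (Real.exp_pos u).le]
    · have : Real.exp u ≤ 1 := Real.exp_le_one_iff.2 (by linarith)
      nlinarith

section

variable {Ω : Type*} [MeasurableSpace Ω] {μ : Measure Ω}

theorem integrable_exp_mul_of_integrable_exp_abs {X : Ω → ℝ} (hX : AEMeasurable X μ) {a l : ℝ}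
    (h : Integrable (fun ω => Real.exp (a * |X ω|)) μ) (hl : |l| ≤ a) :
    Integrable (fun ω => Real.exp (l * X ω)) μ := by
  refine h.mono' (by fun_prop) (Filter.Eventually.of_forall fun ω => ?_)
  rw [Real.norm_eq_abs, Real.abs_exp]
  refine Real.exp_le_exp.2 ((le_abs_self _).trans ?_)
  rw [abs_mul]
  gcongr

/-- Expand the exponential to second order: centring kills the linear term. Half of the exponential
moment controls the remainder and the other half absorbs the factor `X ^ 2`. -/
theorem exists_mgf_le_exp_mul_sq [IsProbabilityMeasure μ] {X : Ω → ℝ} (hX : AEMeasurable X μ)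
    {a : ℝ} (ha : 0 < a) (h : Integrable (fun ω => Real.exp (a * |X ω|)) μ)
    (h0 : ∫ ω, X ω ∂μ = 0) :
    ∃ K : ℝ, 0 ≤ K ∧ ∀ l : ℝ, |l| ≤ a / 2 → mgf X μ l ≤ Real.exp (K * l ^ 2) := by
  have hint : Integrable X μ := by
    refine (h.const_mul a⁻¹).mono' hX.aestronglyMeasurable (Filter.Eventually.of_forall fun ω => ?_)
    rw [Real.norm_eq_abs, le_inv_mul_iff₀ ha]
    linarith [Real.add_one_le_exp (a * |X ω|)]
  have hint2 : Integrable (fun ω => X ω ^ 2 * Real.exp (a / 2 * |X ω|)) μ := by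
    refine (h.const_mul (8 / a ^ 2)).mono' (by fun_prop) (Filter.Eventually.of_forall fun ω => ?_)
    rw [Real.norm_eq_abs, abs_of_nonneg (by positivity)]
    have h1 := Real.quadratic_le_exp_of_nonneg (x := a / 2 * |X ω|) (by positivity)
    have h2 : X ω ^ 2 ≤ 8 / a ^ 2 * Real.exp (a / 2 * |X ω|) := by
      rw [div_mul_eq_mul_div, le_div_iff₀ (by positivity)]
      have : (a / 2 * |X ω|) ^ 2 = a ^ 2 / 4 * X ω ^ 2 := by rw [mul_pow, sq_abs]; ring
      have : 0 ≤ a / 2 * |X ω| := by positivity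
      nlinarith
    calc X ω ^ 2 * Real.exp (a / 2 * |X ω|)
        ≤ 8 / a ^ 2 * Real.exp (a / 2 * |X ω|) * Real.exp (a / 2 * |X ω|) := by gcongr
      _ = 8 / a ^ 2 * Real.exp (a * |X ω|) := by
        rw [mul_assoc, ← Real.exp_add]; ring_nf
  refine ⟨∫ ω, X ω ^ 2 * Real.exp (a / 2 * |X ω|) ∂μ, integral_nonneg fun ω => by positivity,
    fun l hl => ?_⟩
  have h3 : mgf X μ l ≤
      ∫ ω, (1 + l * X ω + l ^ 2 * (X ω ^ 2 * Real.exp (a / 2 * |X ω|))) ∂μ := by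
    refine integral_mono (integrable_exp_mul_of_integrable_exp_abs hX h (hl.trans (by linarith)))
      (((integrable_const 1).add (hint.const_mul l)).add (hint2.const_mul _)) fun ω => ?_
    refine (exp_le_one_add_add_sq_mul_exp_abs (l * X ω)).trans ?_
    rw [mul_pow, abs_mul, mul_assoc (l ^ 2)]
    gcongr
  have hint1 : Integrable (fun ω => 1 + l * X ω) μ := (integrable_const 1).add (hint.const_mul l)
  rw [integral_add hint1 (hint2.const_mul _), integral_add (integrable_const 1)
    (hint.const_mul l), integral_const_mul, integral_const_mul, h0] at h3
  refine h3.trans ((le_of_eq ?_).trans (Real.add_one_le_exp _))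
  simp
  ring

theorem momentNorm_eq_lpNorm {f : Ω → ℝ} (hf : AEStronglyMeasurable f μ) {p : ℝ} (hp : 0 < p) :
    momentNorm μ f p = lpNorm f (ENNReal.ofReal p) μ := by
  rw [lpNorm_eq_integral_norm_rpow_toReal (by simpa using hp) (by simp) hf,
    ENNReal.toReal_ofReal hp.le, momentNorm, one_div]
  rfl

theorem momentNorm_mono [IsProbabilityMeasure μ] {f : Ω → ℝ} {p q : ℝ} (hp : 0 < p) (hpq : p ≤ q)
    (hf : MemLp f (ENNReal.ofReal q) μ) : momentNorm μ f p ≤ momentNorm μ f q := by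
  rw [momentNorm_eq_lpNorm hf.1 hp, momentNorm_eq_lpNorm hf.1 (hp.trans_le hpq),
    ← toReal_eLpNorm hf.1, ← toReal_eLpNorm hf.1]
  exact ENNReal.toReal_mono hf.eLpNorm_ne_top
    (eLpNorm_le_eLpNorm_of_exponent_le (ENNReal.ofReal_le_ofReal hpq) hf.1)

/-- Integrate `|s| ^ p ≤ (p / t) ^ p * exp (t * |s|)`; the two signs cost a factor `2 ^ (1 / p) ≤
2`. -/
theorem momentNorm_le_of_mgf_le [IsProbabilityMeasure μ] {S : Ω → ℝ} {p t D : ℝ}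
    (hp : 1 ≤ p) (ht : 0 < t)
    (hi : Integrable (fun ω => Real.exp (t * S ω)) μ)
    (hi' : Integrable (fun ω => Real.exp (-t * S ω)) μ)
    (h1 : mgf S μ t ≤ Real.exp (D * p)) (h2 : mgf S μ (-t) ≤ Real.exp (D * p)) :
    momentNorm μ S p ≤ 2 * Real.exp D * (p / t) := by
  have hp0 : 0 < p := by linarith
  have hb : ∫ ω, |S ω| ^ p ∂μ ≤ (p / t) ^ p * (2 * Real.exp (D * p)) := by
    calc ∫ ω, |S ω| ^ p ∂μ
        ≤ ∫ ω, (p / t) ^ p * (Real.exp (t * S ω) + Real.exp (-t * S ω)) ∂μ := by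
          refine integral_mono (integrable_rpow_abs_of_integrable_exp_mul ht.ne' hi hi' hp0.le)
            ((hi.add hi').const_mul _) fun ω => ?_
          refine (rpow_abs_le_mul_max_exp_of_pos (S ω) hp0.le ht).trans ?_
          gcongr
          exact max_le_add_of_nonneg (Real.exp_pos _).le (Real.exp_pos _).le
      _ = (p / t) ^ p * (mgf S μ t + mgf S μ (-t)) := by
          rw [integral_const_mul, integral_add hi hi']; rfl
      _ ≤ _ := by gcongr; linarith
  calc momentNorm μ S p ≤ ((p / t) ^ p * (2 * Real.exp (D * p))) ^ (1 / p) := by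
        unfold momentNorm
        gcongr
    _ = p / t * (2 ^ (1 / p) * Real.exp D) := by
        rw [Real.mul_rpow (by positivity) (by positivity), Real.mul_rpow (by positivity)
          (by positivity), ← Real.rpow_mul (by positivity), mul_one_div_cancel hp0.ne',
          Real.rpow_one, ← Real.exp_mul, mul_assoc, mul_one_div_cancel hp0.ne', mul_one]
    _ ≤ p / t * (2 ^ (1 : ℝ) * Real.exp D) := by
        gcongr
        · norm_num
        · exact (div_le_one hp0).2 hp
    _ = _ := by rw [Real.rpow_one]; ring

variable {ι : Type*} [Fintype ι] {X : ι → Ω → ℝ} {l₀ K M : ℝ} {θ : ι → ℝ}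

theorem integrable_exp_mul_weighted_sum [IsProbabilityMeasure μ] (hX : iIndepFun X μ)
    (hmeas : ∀ i, Measurable (X i))
    (hint : ∀ i l, |l| ≤ l₀ → Integrable (fun ω => Real.exp (l * X i ω)) μ)
    (hM : ∀ i, |θ i| ≤ M) {t : ℝ} (ht : |t| * M ≤ l₀) :
    Integrable (fun ω => Real.exp (t * ∑ i, θ i * X i ω)) μ := by
  have hind : iIndepFun (fun i ω => θ i * X i ω) μ :=
    hX.comp (fun i x => θ i * x) (fun i => by fun_prop)
  have := hind.integrable_exp_mul_sum (t := t) (s := Finset.univ) (fun i => by fun_prop)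
    fun i _ => by
      simp_rw [← mul_assoc]
      refine hint i _ (le_trans ?_ ht)
      rw [abs_mul]
      gcongr
      exact hM i
  simpa using this

theorem mgf_weighted_sum_le [IsProbabilityMeasure μ] (hX : iIndepFun X μ)
    (hmeas : ∀ i, Measurable (X i))
    (hmgf : ∀ i l, |l| ≤ l₀ → mgf (X i) μ l ≤ Real.exp (K * l ^ 2))
    (hM : ∀ i, |θ i| ≤ M) (hθ : ∑ i, θ i ^ 2 = 1) {t : ℝ} (ht : |t| * M ≤ l₀) :
    mgf (fun ω => ∑ i, θ i * X i ω) μ t ≤ Real.exp (K * t ^ 2) := by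
  have hind : iIndepFun (fun i ω => θ i * X i ω) μ :=
    hX.comp (fun i x => θ i * x) (fun i => by fun_prop)
  have := hind.mgf_sum (t := t) (fun i => by fun_prop) Finset.univ
  have heq : (fun ω => ∑ i, θ i * X i ω) = ∑ i, fun ω => θ i * X i ω := by ext; simp
  rw [heq, this]
  calc ∏ i, mgf (fun ω => θ i * X i ω) μ t ≤ ∏ i, Real.exp (K * (θ i * t) ^ 2) := by
        refine Finset.prod_le_prod (fun i _ => mgf_nonneg) fun i _ => ?_
        rw [mgf_const_mul]
        refine hmgf i _ (le_trans ?_ ht)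
        rw [abs_mul, mul_comm]
        gcongr
        exact hM i
    _ = Real.exp (K * t ^ 2) := by
        rw [← Real.exp_sum]
        simp_rw [mul_pow]
        rw [← Finset.mul_sum, ← Finset.sum_mul, hθ, one_mul]

theorem momentNorm_weighted_sum_le [IsProbabilityMeasure μ] (hX : iIndepFun X μ)
    (hmeas : ∀ i, Measurable (X i)) (hl₀ : 0 < l₀) (hK : 0 ≤ K)
    (hint : ∀ i l, |l| ≤ l₀ → Integrable (fun ω => Real.exp (l * X i ω)) μ)
    (hmgf : ∀ i l, |l| ≤ l₀ → mgf (X i) μ l ≤ Real.exp (K * l ^ 2))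
    (hM0 : 0 < M) (hM : ∀ i, |θ i| ≤ M) (hθ : ∑ i, θ i ^ 2 = 1) {p : ℝ} (hp : 1 ≤ p) :
    momentNorm μ (fun ω => ∑ i, θ i * X i ω) p ≤ 2 * Real.exp K * (p * M / l₀ + √p) := by
  have hp0 : 0 < p := by linarith
  -- The largest `t` that keeps every `t * |θ i|` in the range of the mgf bound and satisfies `t ^ 2
  -- ≤ p`. Then `p / t` is either `p * M / l₀` or `√p`.
  set t := min (l₀ / M) (√p)
  have ht : 0 < t := lt_min (by positivity) (by positivity)
  have htM : |t| * M ≤ l₀ := by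
    rw [abs_of_pos ht, ← le_div_iff₀ hM0]
    exact min_le_left _ _
  have htp : K * t ^ 2 ≤ K * p := by
    gcongr
    calc t ^ 2 ≤ √p ^ 2 := by gcongr; exact min_le_right _ _
      _ = p := Real.sq_sqrt hp0.le
  have hle : ∀ r : ℝ, |r| * M ≤ l₀ → r ^ 2 = t ^ 2 →
      mgf (fun ω => ∑ i, θ i * X i ω) μ r ≤ Real.exp (K * p) := fun r hr hrt =>
    (mgf_weighted_sum_le hX hmeas hmgf hM hθ hr).trans (Real.exp_le_exp.2 (hrt ▸ htp))
  refine (momentNorm_le_of_mgf_le hp ht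
    (integrable_exp_mul_weighted_sum hX hmeas hint hM htM)
    (integrable_exp_mul_weighted_sum hX hmeas hint hM (by rwa [abs_neg]))
    (hle t htM rfl) (hle (-t) (by rwa [abs_neg]) (by ring))).trans ?_
  gcongr
  rcases min_choice (l₀ / M) (√p) with h | h
  · rw [show t = l₀ / M from h, div_div_eq_mul_div]
    linarith [Real.sqrt_nonneg p]
  · rw [show t = √p from h, Real.div_sqrt]
    have : 0 ≤ p * M / l₀ := by positivity
    linarith

theorem memLp_weighted_sum [IsProbabilityMeasure μ] (hX : iIndepFun X μ)
    (hmeas : ∀ i, Measurable (X i)) (hl₀ : 0 < l₀)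
    (hint : ∀ i l, |l| ≤ l₀ → Integrable (fun ω => Real.exp (l * X i ω)) μ)
    (hM0 : 0 < M) (hM : ∀ i, |θ i| ≤ M) (q : NNReal) :
    MemLp (fun ω => ∑ i, θ i * X i ω) q μ := by
  refine memLp_of_mem_interior_integrableExpSet ?_ q
  rw [mem_interior_iff_mem_nhds, Metric.mem_nhds_iff]
  refine ⟨l₀ / M, by positivity, fun t ht => ?_⟩
  refine integrable_exp_mul_weighted_sum hX hmeas hint hM ?_
  rw [← le_div_iff₀ hM0]
  simpa using (Metric.mem_ball.1 ht).le

end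

/-! ### Lower bound through symmetrisation -/

theorem factorial_two_mul_div_le (j : ℕ) :
    ((2 * j).factorial / j.factorial : ℝ) ≤ (2 * j : ℝ) ^ j := by
  rw [div_le_iff₀ (by positivity), mul_comm (_ ^ j)]
  have h : (2 * j).factorial ≤ j.factorial * (2 * j) ^ j := by
    rw [two_mul, ← Nat.factorial_mul_ascFactorial]
    gcongr
    exact Nat.ascFactorial_le_pow_add j j
  exact_mod_cast h

theorem pow_le_factorial_two_mul_div (k : ℕ) :
    (k : ℝ) ^ k ≤ ((2 * k).factorial / k.factorial : ℝ) := by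
  rw [le_div_iff₀ (by positivity), mul_comm]
  have h := Nat.factorial_mul_pow_le_factorial (m := k) (n := k)
  have h2 : k.factorial * k ^ k ≤ (2 * k).factorial := by
    refine le_trans ?_ (h.trans_eq (by rw [two_mul]))
    gcongr
    omega
  exact_mod_cast h2

section

variable {ρ : Measure ℝ} [IsProbabilityMeasure ρ]

theorem integral_sub_pow_odd_prod_self (j : ℕ) :
    ∫ z, (z.1 - z.2) ^ (2 * j + 1) ∂(ρ.prod ρ) = 0 := by
  have h := integral_prod_swap (μ := ρ) (ν := ρ) (fun z : ℝ × ℝ => (z.1 - z.2) ^ (2 * j + 1))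
  have h2 : ∀ z : ℝ × ℝ, (z.swap.1 - z.swap.2) ^ (2 * j + 1) =
      -((z.1 - z.2) ^ (2 * j + 1)) := fun z => by
    rw [← Odd.neg_pow (odd_two_mul_add_one j)]
    simp
  simp_rw [h2, integral_neg] at h
  linarith

theorem memLp_sub_prod_self (hLp : ∀ m : ℕ, MemLp (fun x : ℝ => x) m ρ) (m : ℕ) :
    MemLp (fun z : ℝ × ℝ => z.1 - z.2) m (ρ.prod ρ) :=
  ((hLp m).comp_measurePreserving measurePreserving_fst).sub
    ((hLp m).comp_measurePreserving measurePreserving_snd)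

/-- Markov's inequality on the event that one copy is at most `b - t` and the other at least `b`,
whose probability is at least `c ^ 2 * exp (-t)`. -/
theorem pow_mul_exp_neg_le_integral_sub_pow (hLp : ∀ m : ℕ, MemLp (fun x : ℝ => x) m ρ)
    {b c t : ℝ} (hc : 0 ≤ c) (ht : 0 ≤ t)
    (hlow : c * Real.exp (-t) ≤ ρ.real (Set.Iic (b - t))) (hhigh : c ≤ ρ.real (Set.Ici b))
    (k : ℕ) :
    t ^ (2 * k) * (c ^ 2 * Real.exp (-t)) ≤ ∫ z, (z.1 - z.2) ^ (2 * k) ∂(ρ.prod ρ) := by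
  have h := mul_meas_ge_le_integral_of_nonneg (μ := ρ.prod ρ)
    (f := fun z : ℝ × ℝ => (z.1 - z.2) ^ (2 * k))
    (Filter.Eventually.of_forall fun z => (even_two_mul k).pow_nonneg _)
    (integrable_pow_of_forall_memLp (memLp_sub_prod_self hLp) _) (t ^ (2 * k))
  refine le_trans (mul_le_mul_of_nonneg_left ?_ (by positivity)) h
  calc c ^ 2 * Real.exp (-t) = c * Real.exp (-t) * c := by ring
    _ ≤ ρ.real (Set.Iic (b - t)) * ρ.real (Set.Ici b) := by gcongr
    _ = (ρ.prod ρ).real (Set.Iic (b - t) ×ˢ Set.Ici b) := (measureReal_prod_prod _ _).symm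
    _ ≤ _ := by
      refine measureReal_mono fun z hz => ?_
      have h1 : z.1 ≤ b - t := hz.1
      have h2 : b ≤ z.2 := hz.2
      rw [Set.mem_ofPred_eq, ← (even_two_mul k).pow_abs (z.1 - z.2)]
      gcongr
      rw [le_abs]
      right
      linarith

variable {ι : Type*} [Fintype ι] {θ : ι → ℝ}

/-- Independent pairs regroup into two independent copies of the whole vector, so the symmetrised
sum is a difference of two copies of the original one. -/
theorem integral_weighted_sum_sub_pow (k : ℕ) :
    ∫ z, (∑ i, θ i * ((z i).1 - (z i).2)) ^ k ∂(Measure.pi fun _ : ι => ρ.prod ρ) =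
      ∫ w, ((∑ i, θ i * w.1 i) - ∑ i, θ i * w.2 i) ^ k
        ∂((Measure.pi fun _ : ι => ρ).prod (Measure.pi fun _ : ι => ρ)) := by
  rw [← (measurePreserving_arrowProdEquivProdArrow ℝ ℝ ι (fun _ => ρ) (fun _ => ρ)).integral_comp']
  congr 1
  ext z
  rw [← Finset.sum_sub_distrib]
  simp [MeasurableEquiv.arrowProdEquivProdArrow, Equiv.arrowProdEquivProdArrow, mul_sub]

theorem sub_pow_two_mul_le (a b : ℝ) (k : ℕ) :
    (a - b) ^ (2 * k) ≤ 4 ^ k * (a ^ (2 * k) + b ^ (2 * k)) := by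
  simp_rw [pow_mul]
  calc ((a - b) ^ 2) ^ k ≤ (4 * max (a ^ 2) (b ^ 2)) ^ k := by
        gcongr
        have := le_max_left (a ^ 2) (b ^ 2)
        have := le_max_right (a ^ 2) (b ^ 2)
        nlinarith [sq_nonneg (a + b)]
    _ = 4 ^ k * max (a ^ 2) (b ^ 2) ^ k := mul_pow _ _ _
    _ ≤ _ := by
        gcongr
        rcases max_choice (a ^ 2) (b ^ 2) with h | h <;> rw [h]
        · exact le_add_of_nonneg_right (by positivity)
        · exact le_add_of_nonneg_left (by positivity)

theorem memLp_weighted_sum_pi (hLp : ∀ m : ℕ, MemLp (fun x : ℝ => x) m ρ) (m : ℕ) :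
    MemLp (fun x : ι → ℝ => ∑ i, θ i * x i) m (Measure.pi fun _ : ι => ρ) :=
  memLp_finsetSum _ fun i _ =>
    ((hLp m).comp_measurePreserving (measurePreserving_eval (fun _ : ι => ρ) i)).const_mul _

theorem integral_symmetrized_le (hLp : ∀ m : ℕ, MemLp (fun x : ℝ => x) m ρ) (k : ℕ) :
    ∫ z, (∑ i, θ i * ((z i).1 - (z i).2)) ^ (2 * k) ∂(Measure.pi fun _ : ι => ρ.prod ρ) ≤
      2 * 4 ^ k * ∫ x, (∑ i, θ i * x i) ^ (2 * k) ∂(Measure.pi fun _ : ι => ρ) := by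
  rw [integral_weighted_sum_sub_pow]
  set P := Measure.pi fun _ : ι => ρ
  have hS : ∀ m : ℕ, MemLp (fun x : ι → ℝ => ∑ i, θ i * x i) m P := memLp_weighted_sum_pi hLp
  have h1 : ∀ m : ℕ, MemLp (fun w : (ι → ℝ) × (ι → ℝ) => ∑ i, θ i * w.1 i) m (P.prod P) := fun m =>
    (hS m).comp_measurePreserving measurePreserving_fst
  have h2 : ∀ m : ℕ, MemLp (fun w : (ι → ℝ) × (ι → ℝ) => ∑ i, θ i * w.2 i) m (P.prod P) := fun m =>
    (hS m).comp_measurePreserving measurePreserving_snd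
  have i1 := integrable_pow_of_forall_memLp h1 (2 * k)
  have i2 := integrable_pow_of_forall_memLp h2 (2 * k)
  calc _ ≤ ∫ w, 4 ^ k * ((∑ i, θ i * w.1 i) ^ (2 * k) + (∑ i, θ i * w.2 i) ^ (2 * k))
        ∂(P.prod P) :=
        integral_mono (integrable_pow_of_forall_memLp (fun m => (h1 m).sub (h2 m)) _)
          ((i1.add i2).const_mul _) fun w => sub_pow_two_mul_le _ _ k
    _ = _ := by
        rw [integral_const_mul, integral_add i1 i2,
          integral_fun_fst (μ := P) (ν := P) (fun x => (∑ i, θ i * x i) ^ (2 * k)),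
          integral_fun_snd (μ := P) (ν := P) (fun x => (∑ i, θ i * x i) ^ (2 * k))]
        simp
        ring

theorem pow_le_integral_weighted_sum_pow (hLp : ∀ m : ℕ, MemLp (fun x : ℝ => x) m ρ)
    {b c : ℝ} (hc : 0 ≤ c) (hc1 : c ≤ 1)
    (hlow : ∀ t, 0 ≤ t → c * Real.exp (-t) ≤ ρ.real (Set.Iic (b - t)))
    (hhigh : c ≤ ρ.real (Set.Ici b)) (hθ : ∑ i, θ i ^ 2 = 1) {k : ℕ} (hk : 1 ≤ k) :
    (c / Real.exp 1) ^ (2 * k) * k ^ k ≤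
      2 * 4 ^ k * ∫ x, (∑ i, θ i * x i) ^ (2 * k) ∂(Measure.pi fun _ : ι => ρ) ∧
    ∀ i, (c / Real.exp 1 * (2 * k * |θ i|)) ^ (2 * k) ≤
      2 * 4 ^ k * ∫ x, (∑ i, θ i * x i) ^ (2 * k) ∂(Measure.pi fun _ : ι => ρ) := by
  set d := c / Real.exp 1
  have hmom : ∀ j : ℕ, 1 ≤ j →
      (d * (2 * j)) ^ (2 * j) ≤ ∫ z, (z.1 - z.2) ^ (2 * j) ∂(ρ.prod ρ) := fun j hj => by
    -- The choice `t = 2 * j` makes the tail factor `exp (-t)` a `2 * j`-th power; `c ≤ 1` allows `c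
    -- ^ 2` to be lowered to `c ^ (2 * j)`.
    refine le_trans ?_ (pow_mul_exp_neg_le_integral_sub_pow hLp hc (t := 2 * j) (by positivity)
      (hlow _ (by positivity)) hhigh j)
    rw [mul_pow, mul_comm]
    gcongr
    rw [div_pow, Real.exp_neg, ← div_eq_mul_inv, ← Real.exp_nat_mul]
    push_cast
    rw [mul_one]
    gcongr ?_ / _
    exact pow_le_pow_of_le_one hc hc1 (by omega)
  set Q := Measure.pi fun _ : ι => ρ.prod ρ
  have heval : ∀ i (m : ℕ), ∫ z, (θ i * ((z i).1 - (z i).2)) ^ m ∂Q =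
      θ i ^ m * ∫ z, (z.1 - z.2) ^ m ∂(ρ.prod ρ) := fun i m => by
    simp_rw [mul_pow, integral_const_mul]
    congr 1
    exact integral_comp_eval (μ := fun _ : ι => ρ.prod ρ) (i := i)
      (f := fun z : ℝ × ℝ => (z.1 - z.2) ^ m) (by fun_prop)
  have hind : iIndepFun (fun (i : ι) (z : ι → ℝ × ℝ) => θ i * ((z i).1 - (z i).2)) Q :=
    iIndepFun_pi (X := fun i (z : ℝ × ℝ) => θ i * (z.1 - z.2)) fun i => by fun_prop
  obtain ⟨-, h2, h3⟩ := even_moments_sum_of_iIndepFun hind (fun i => by fun_prop)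
    (fun i m => ((memLp_sub_prod_self hLp m).comp_measurePreserving
      (measurePreserving_eval (fun _ : ι => ρ.prod ρ) i)).const_mul _)
    (fun i j => by rw [heval, integral_sub_pow_odd_prod_self, mul_zero])
    (v := fun i => d ^ 2 * θ i ^ 2) (fun i => by positivity)
    (fun i j => by
      rw [heval, mul_comm (d ^ 2), mul_pow, ← pow_mul, ← pow_mul, mul_assoc]
      refine mul_le_mul_of_nonneg_left ?_ ((even_two_mul j).pow_nonneg _)
      rcases Nat.eq_zero_or_pos j with rfl | hj
      · simp
      refine le_trans ?_ (hmom j hj)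
      rw [mul_pow]
      gcongr
      -- Exponential-type moments, of order `(2 * j) ^ (2 * j)`, exceed the Gaussian `(2 * j) ^ j`.
      refine (factorial_two_mul_div_le j).trans (pow_le_pow_right₀ ?_ (by omega))
      have : (1 : ℝ) ≤ j := by exact_mod_cast hj
      linarith) Finset.univ
  have hsym := integral_symmetrized_le (θ := θ) hLp k
  refine ⟨le_trans ?_ ((h2 k).trans hsym), fun i => le_trans ?_
    ((h3 i (Finset.mem_univ i) k).trans hsym)⟩
  · rw [← Finset.mul_sum, hθ, mul_one, ← pow_mul]
    gcongr
    exact pow_le_factorial_two_mul_div k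
  · rw [heval, ← mul_assoc, mul_pow, (even_two_mul k).pow_abs, mul_comm]
    exact mul_le_mul_of_nonneg_left (hmom k hk) ((even_two_mul k).pow_nonneg _)

end

/-! ### From integer moments to norms, and the first moment -/

section

variable {Ω : Type*} [MeasurableSpace Ω] {μ : Measure Ω}

theorem momentNorm_natCast (f : Ω → ℝ) (k : ℕ) :
    momentNorm μ f k = (∫ ω, |f ω| ^ k ∂μ) ^ (1 / (k : ℝ)) := by
  simp_rw [momentNorm, Real.rpow_natCast]

theorem le_momentNorm_of_pow_le {f : Ω → ℝ} {k : ℕ} (hk : k ≠ 0) {x : ℝ} (hx : 0 ≤ x)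
    (h : x ^ k ≤ ∫ ω, |f ω| ^ k ∂μ) : x ≤ momentNorm μ f k := by
  rw [momentNorm_natCast, one_div]
  calc x = (x ^ k) ^ ((k : ℝ)⁻¹) := (Real.pow_rpow_inv_natCast hx hk).symm
    _ ≤ _ := by gcongr

theorem momentNorm_natCast_pow (f : Ω → ℝ) {k : ℕ} (hk : k ≠ 0) :
    momentNorm μ f k ^ k = ∫ ω, |f ω| ^ k ∂μ := by
  rw [momentNorm_natCast, one_div]
  exact Real.rpow_inv_natCast_pow (integral_nonneg fun ω => by positivity) hk

/-- Desymmetrisation costs `2 * 4 ^ k ≤ 16 ^ k`, whose `2 * k`-th root is at most `4`. -/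
theorem div_four_le_momentNorm {f : Ω → ℝ} {k : ℕ} (hk : 1 ≤ k) {x : ℝ} (hx : 0 ≤ x)
    (h : x ^ (2 * k) ≤ 2 * 4 ^ k * ∫ ω, f ω ^ (2 * k) ∂μ) :
    x / 4 ≤ momentNorm μ f (2 * k : ℕ) := by
  refine le_momentNorm_of_pow_le (by omega) (by positivity) ?_
  simp_rw [(even_two_mul k).pow_abs]
  rw [div_pow, div_le_iff₀ (by positivity), mul_comm (∫ ω, f ω ^ (2 * k) ∂μ)]
  refine h.trans ?_
  have h0 : 0 ≤ ∫ ω, f ω ^ (2 * k) ∂μ := integral_nonneg fun ω => (even_two_mul k).pow_nonneg _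
  gcongr
  rw [two_mul k, pow_add]
  gcongr
  calc (2 : ℝ) ≤ 4 ^ 1 := by norm_num
    _ ≤ 4 ^ k := pow_le_pow_right₀ (by norm_num) hk

/-- With `w = α * |x|` this is `4 * w ^ 3 - 27 * w + 27 = (2 * w - 3) ^ 2 * (w + 3) ≥ 0`. -/
theorem mul_sq_sub_mul_pow_four_le_abs {α : ℝ} (hα : 0 < α) (x : ℝ) :
    α * x ^ 2 - 4 / 27 * α ^ 3 * x ^ 4 ≤ |x| := by
  rw [← sq_abs, show x ^ 4 = |x| ^ 4 from (Even.pow_abs (by decide) x).symm]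
  have h : 0 ≤ |x| := abs_nonneg x
  generalize |x| = u at *
  have h2 : 0 ≤ u * ((2 * α * u - 3) ^ 2 * (α * u + 3)) := by positivity
  nlinarith

theorem le_momentNorm_one [IsProbabilityMeasure μ] {f : Ω → ℝ} (hf : ∀ m : ℕ, MemLp f m μ)
    {A B : ℝ} (hA : 0 < A) (hB : 0 < B) (h2 : A ≤ ∫ ω, f ω ^ 2 ∂μ) (h4 : ∫ ω, f ω ^ 4 ∂μ ≤ B) :
    √(A / B) * A / 2 ≤ momentNorm μ f 1 := by
  -- Makes `α ^ 3 * B = α * A`, so that a fraction `23 / 27` of `α * A` survives.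
  set α := √(A / B)
  have hα : 0 < α := by positivity
  have hα2 : α ^ 2 * B = A := by
    rw [Real.sq_sqrt (by positivity)]
    field_simp
  have i1 : Integrable f μ := by simpa using integrable_pow_of_forall_memLp hf 1
  have i2 := integrable_pow_of_forall_memLp hf 2
  have i4 := integrable_pow_of_forall_memLp hf 4
  have h := integral_mono ((i2.const_mul α).sub (i4.const_mul (4 / 27 * α ^ 3))) i1.abs
    fun ω => mul_sq_sub_mul_pow_four_le_abs hα (f ω)
  have h' : α * ∫ ω, f ω ^ 2 ∂μ - 4 / 27 * α ^ 3 * ∫ ω, f ω ^ 4 ∂μ ≤ ∫ ω, |f ω| ∂μ := by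
    rw [integral_sub' (i2.const_mul α) (i4.const_mul (4 / 27 * α ^ 3)), integral_const_mul,
      integral_const_mul] at h
    exact h
  have h1 : momentNorm μ f 1 = ∫ ω, |f ω| ∂μ := by simp [momentNorm]
  rw [h1]
  have e1 : α * A ≤ α * ∫ ω, f ω ^ 2 ∂μ := by gcongr
  have e2 : 4 / 27 * α ^ 3 * ∫ ω, f ω ^ 4 ∂μ ≤ 4 / 27 * α ^ 3 * B := by gcongr
  have e3 : α ^ 3 * B = α * A := by rw [← hα2]; ring
  have e4 : 0 < α * A := by positivity
  nlinarith

end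

/-! ### Two-sided moment estimate for exponential tails -/

/-- A law with the tails of an exponential variable: it is centred with a finite exponential moment,
and to the left of some point its tail is at least a multiple of `e^{-t}`. -/
structure HasExponentialTails (ρ : Measure ℝ) : Prop where
  exists_integrable_exp : ∃ a > 0, Integrable (fun x => Real.exp (a * |x|)) ρ
  integral_eq_zero : ∫ x, x ∂ρ = 0
  exists_tail : ∃ b c : ℝ, 0 < c ∧ c ≤ ρ.real (Set.Ici b) ∧
    ∀ t, 0 ≤ t → c * Real.exp (-t) ≤ ρ.real (Set.Iic (b - t))

theorem HasExponentialTails.exists_momentNorm_equiv {ρ : Measure ℝ} [IsProbabilityMeasure ρ]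
    (hρ : HasExponentialTails ρ) :
    ∃ C₁ C₂ : ℝ, 0 < C₁ ∧ 0 < C₂ ∧ ∀ (n : ℕ) (p : ℝ), 1 ≤ p → ∀ (θ : Fin n → ℝ) (M : ℝ),
      ∑ i, θ i ^ 2 = 1 → (∀ i, |θ i| ≤ M) → (∃ i, |θ i| = M) →
      MemLp (fun x : Fin n → ℝ => ∑ i, θ i * x i) (ENNReal.ofReal p)
        (Measure.pi fun _ : Fin n => ρ) ∧
      C₁ * (p * M + √p) ≤
        momentNorm (Measure.pi fun _ : Fin n => ρ) (fun x => ∑ i, θ i * x i) p ∧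
      momentNorm (Measure.pi fun _ : Fin n => ρ) (fun x => ∑ i, θ i * x i) p ≤
        C₂ * (p * M + √p) := by
  obtain ⟨a, ha, hexp⟩ := hρ.exists_integrable_exp
  obtain ⟨b, c, hc, hhigh, hlow⟩ := hρ.exists_tail
  obtain ⟨K, hK, hmgf⟩ := exists_mgf_le_exp_mul_sq (X := fun x : ℝ => x) (by fun_prop) ha hexp
    hρ.integral_eq_zero
  have hint : ∀ l : ℝ, |l| ≤ a / 2 → Integrable (fun x : ℝ => Real.exp (l * x)) ρ := fun l hl =>
    integrable_exp_mul_of_integrable_exp_abs (X := fun x : ℝ => x) (by fun_prop) hexp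
      (hl.trans (by linarith))
  have hLp : ∀ m : ℕ, MemLp (fun x : ℝ => x) m ρ := fun m => by
    refine memLp_of_mem_interior_integrableExpSet (X := fun x : ℝ => x) ?_ m
    rw [mem_interior_iff_mem_nhds, Metric.mem_nhds_iff]
    refine ⟨a / 2, by positivity, fun t ht => hint t ?_⟩
    simpa using (Metric.mem_ball.1 ht).le
  have hc1 : c ≤ 1 := hhigh.trans measureReal_le_one
  set d := c / Real.exp 1
  have hd : 0 < d := by positivity
  set U := 2 * Real.exp K
  have hU : 0 < U := by positivity
  -- `T` is the upper bound at exponent `4` with `M` replaced by `1`; `A` below bounds the second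
  -- moment from below, by the case `k = 1` of the even-moment estimate.
  set T := U * (4 * 1 / (a / 2) + √4)
  have hT : 0 < T := by positivity
  set A := d ^ 2 / 8
  have hA : 0 < A := by positivity
  set E := √(A / T ^ 4) * A / 2
  have hE : 0 < E := by positivity
  refine ⟨min (d / 16) (E / 4), U * (2 / a + 1), by positivity, by positivity,
    fun n p hp θ M hθ hM ⟨i₀, hi₀⟩ => ?_⟩
  have hp0 : 0 < p := by linarith
  have hM0 : 0 < M := by
    rcases (hi₀ ▸ abs_nonneg _ : 0 ≤ M).eq_or_lt with h | h
    · have : ∀ i, θ i = 0 := fun i => abs_nonpos_iff.1 (h ▸ hM i)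
      simp [this] at hθ
    · exact h
  have hM1 : M ≤ 1 := by
    rw [← hi₀, ← sq_le_one_iff_abs_le_one, ← hθ]
    exact Finset.single_le_sum (fun i _ => sq_nonneg (θ i)) (Finset.mem_univ i₀)
  set P := Measure.pi fun _ : Fin n => ρ
  have hP : ∀ i, MeasurePreserving (fun x : Fin n → ℝ => x i) P ρ := fun i =>
    measurePreserving_eval (fun _ : Fin n => ρ) i
  have hind : iIndepFun (fun (i : Fin n) (x : Fin n → ℝ) => x i) P :=
    iIndepFun_pi (X := fun _ (x : ℝ) => x) fun i => by fun_prop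
  have hmeas : ∀ i : Fin n, Measurable fun x : Fin n → ℝ => x i := fun i => by fun_prop
  have hint' : ∀ (i : Fin n) (l : ℝ), |l| ≤ a / 2 →
      Integrable (fun x : Fin n → ℝ => Real.exp (l * x i)) P := fun i l hl =>
    (hP i).integrable_comp_of_integrable (hint l hl)
  have hmgf' : ∀ (i : Fin n) (l : ℝ), |l| ≤ a / 2 →
      mgf (fun x : Fin n → ℝ => x i) P l ≤ Real.exp (K * l ^ 2) := fun i l hl => by
    refine le_of_eq_of_le ?_ (hmgf l hl)
    exact integral_comp_eval (μ := fun _ : Fin n => ρ) (i := i)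
      (f := fun x : ℝ => Real.exp (l * x)) (by fun_prop)
  have hup : ∀ q : ℝ, 1 ≤ q → momentNorm P (fun x => ∑ i, θ i * x i) q ≤
      U * (q * M / (a / 2) + √q) := fun q hq =>
    momentNorm_weighted_sum_le hind hmeas (by positivity) hK hint' hmgf' hM0 hM hθ hq
  have hmem : ∀ q : NNReal, MemLp (fun x : Fin n → ℝ => ∑ i, θ i * x i) q P := fun q =>
    memLp_weighted_sum hind hmeas (by positivity) hint' hM0 hM q
  have hmem' : ∀ m : ℕ, MemLp (fun x : Fin n → ℝ => ∑ i, θ i * x i) m P := fun m => hmem m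
  refine ⟨hmem p.toNNReal, ?_, (hup p hp).trans ?_⟩
  · rcases le_or_gt 2 p with hp2 | hp2
    · set k := ⌊p / 2⌋₊
      have hk : 1 ≤ k := by
        rw [Nat.one_le_floor_iff]
        linarith
      have hk1 : (1 : ℝ) ≤ k := by exact_mod_cast hk
      have hk2 : (k : ℝ) ≤ p / 2 := Nat.floor_le (by positivity)
      have hk3 : p / 2 < k + 1 := Nat.lt_floor_add_one _
      obtain ⟨h1, h2⟩ := pow_le_integral_weighted_sum_pow hLp hc.le hc1 hlow hhigh hθ hk
      have h3 := div_four_le_momentNorm hk (x := d * (2 * k * |θ i₀|)) (by positivity) (h2 i₀)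
      have h4 := div_four_le_momentNorm hk (x := d * √k) (by positivity) (by
        rw [mul_pow, pow_mul (√(k : ℝ)), Real.sq_sqrt (by positivity)]
        exact h1)
      have h5 := momentNorm_mono (μ := P) (p := (2 * k : ℕ)) (q := p) (by positivity)
        (by push_cast; linarith) (hmem p.toNNReal)
      rw [hi₀] at h3
      have h6 : √p ≤ 2 * √k := by
        rw [Real.sqrt_le_left (by positivity), mul_pow, Real.sq_sqrt (by positivity)]
        linarith
      have h7 : p * M ≤ 4 * k * M := by gcongr; linarith
      -- The average of the two lower bounds `h3` and `h4`.
      calc min (d / 16) (E / 4) * (p * M + √p) ≤ d / 16 * (4 * k * M + 2 * √k) := by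
            gcongr
            exact min_le_left _ _
        _ ≤ _ := by linarith
    · obtain ⟨h1, -⟩ := pow_le_integral_weighted_sum_pow hLp hc.le hc1 hlow hhigh hθ le_rfl
      have h2 : A ≤ ∫ x, (∑ i, θ i * x i) ^ 2 ∂P := by
        rw [div_le_iff₀ (by norm_num)]
        norm_num at h1
        linarith
      have h4 : ∫ x, (∑ i, θ i * x i) ^ 4 ∂P ≤ T ^ 4 := by
        have := momentNorm_natCast_pow (μ := P) (fun x => ∑ i, θ i * x i) (k := 4) (by norm_num)
        simp_rw [show ∀ y : ℝ, |y| ^ 4 = y ^ 4 from fun y => Even.pow_abs (by decide) y] at this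
        rw [← this]
        have h0 : 0 ≤ momentNorm P (fun x => ∑ i, θ i * x i) (4 : ℕ) :=
          Real.rpow_nonneg (integral_nonneg fun x => by positivity) _
        gcongr
        refine (hup _ (by norm_num)).trans ?_
        change U * _ ≤ U * _
        push_cast
        gcongr
      have h3 : E ≤ _ := le_momentNorm_one hmem' hA (by positivity) h2 h4
      have h5 := momentNorm_mono (μ := P) one_pos hp (hmem p.toNNReal)
      have h6 : p * M + √p ≤ 4 := by
        have : p * M ≤ p * 1 := by gcongr
        have : √p ≤ p := Real.sqrt_le_self_iff.2 (Or.inr hp)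
        linarith
      calc min (d / 16) (E / 4) * (p * M + √p) ≤ E / 4 * 4 := by
            gcongr
            exact min_le_right _ _
        _ ≤ _ := by linarith
  · rw [mul_assoc U]
    refine mul_le_mul_of_nonneg_left ?_ hU.le
    have h1 : 0 ≤ p * M := by positivity
    have h2 : 0 ≤ 2 / a * √p := by positivity
    calc p * M / (a / 2) + √p = 2 / a * (p * M) + √p := by field_simp
      _ ≤ _ := by linarith

/-! ### The two laws have exponential tails -/

theorem mul_sub_le_withDensity_real {f : ℝ → ℝ} {m u v : ℝ} (hm : 0 ≤ m)
    (hf : ∀ x ∈ Set.Icc u v, m ≤ f x)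
    [IsFiniteMeasure (volume.withDensity fun x => ENNReal.ofReal (f x))] {s : Set ℝ}
    (hs : Set.Icc u v ⊆ s) :
    m * (v - u) ≤ (volume.withDensity fun x => ENNReal.ofReal (f x)).real s := by
  refine le_trans ?_ (measureReal_mono hs)
  rw [measureReal_def, withDensity_apply _ measurableSet_Icc,
    ← ENNReal.ofReal_le_iff_le_toReal, ENNReal.ofReal_mul hm, ← Real.volume_Icc,
    ← setLIntegral_const]
  · exact setLIntegral_mono' measurableSet_Icc fun x hx => ENNReal.ofReal_le_ofReal (hf x hx)
  · rw [← withDensity_apply _ measurableSet_Icc]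
    exact measure_ne_top _ _

theorem integrable_exp_neg_mul_abs {a : ℝ} (ha : 0 < a) :
    Integrable fun x : ℝ => Real.exp (-a * |x|) := by
  refine Integrable.of_integral_ne_zero ?_
  rw [integral_comp_abs (f := fun x => Real.exp (-a * x)), integral_exp_mul_Ioi (by linarith)]
  simp [ha.ne']

instance isProbabilityMeasure_symmetricExponential :
    IsProbabilityMeasure symmetricExponential := by
  have h : ∫ t : ℝ, 1 / 2 * Real.exp (-|t|) = 1 := by
    rw [integral_const_mul, integral_comp_abs (f := fun x => Real.exp (-x)),
      integral_exp_neg_Ioi_zero]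
    norm_num
  have hi : Integrable fun t : ℝ => 1 / 2 * Real.exp (-|t|) :=
    Integrable.of_integral_ne_zero (by rw [h]; norm_num)
  constructor
  rw [symmetricExponential, withDensity_apply _ MeasurableSet.univ, Measure.restrict_univ,
    ← ofReal_integral_eq_lintegral_ofReal hi (Filter.Eventually.of_forall fun t => by positivity),
    h, ENNReal.ofReal_one]

theorem hasExponentialTails_symmetricExponential : HasExponentialTails symmetricExponential := by
  have hfin : IsFiniteMeasure
      (volume.withDensity fun t : ℝ => ENNReal.ofReal (1 / 2 * Real.exp (-|t|))) :=
    inferInstanceAs (IsFiniteMeasure symmetricExponential)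
  have hdens : ∀ t : ℝ, (ENNReal.ofReal (1 / 2 * Real.exp (-|t|))).toReal =
      1 / 2 * Real.exp (-|t|) := fun t => ENNReal.toReal_ofReal (by positivity)
  -- Both tails are bounded below on unit intervals, `[0, 1]` and `[-(t + 1), -t]`; hence the factor
  -- `exp (-1)`.
  refine ⟨⟨1 / 2, by norm_num, ?_⟩, ?_, 0, 1 / 2 * Real.exp (-1), by positivity, ?_, fun t ht => ?_⟩
  · rw [symmetricExponential, integrable_withDensity_iff_integrable_smul' (by fun_prop)
      (Filter.Eventually.of_forall fun t => ENNReal.ofReal_lt_top)]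
    refine ((integrable_exp_neg_mul_abs (a := 1 / 2) (by norm_num)).const_mul (1 / 2)).congr
      (Filter.Eventually.of_forall fun t => ?_)
    simp only [hdens, smul_eq_mul, mul_assoc, ← Real.exp_add]
    ring_nf
  · rw [symmetricExponential, integral_withDensity_eq_integral_toReal_smul (by fun_prop)
      (Filter.Eventually.of_forall fun t => ENNReal.ofReal_lt_top)]
    have h := integral_neg_eq_self (fun t : ℝ => (ENNReal.ofReal (1 / 2 * Real.exp (-|t|))).toReal • t)
      volume
    simp only [abs_neg, smul_neg, integral_neg] at h
    linarith
  · refine le_trans (le_of_eq (by ring)) (mul_sub_le_withDensity_real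
      (m := 1 / 2 * Real.exp (-1)) (u := 0) (v := 1) (by positivity)
      (fun x hx => ?_) (Set.Icc_subset_Ici_self))
    gcongr
    exact abs_le.2 ⟨by linarith [hx.1], hx.2⟩
  · refine le_trans (le_of_eq ?_) (mul_sub_le_withDensity_real
      (m := 1 / 2 * Real.exp (-(t + 1))) (u := -(t + 1)) (v := -t) (by positivity)
      (fun x hx => ?_) ?_)
    · rw [mul_assoc, ← Real.exp_add]
      ring_nf
    · gcongr
      exact abs_le.2 ⟨hx.1, by linarith [hx.2]⟩
    · rw [zero_sub]
      exact Set.Icc_subset_Iic_self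

theorem integrable_abs_rpow_mul_exp_neg_mul_sq {b : ℝ} (hb : 0 < b) {s : ℝ} (hs : -1 < s) :
    Integrable fun x : ℝ => |x| ^ s * Real.exp (-b * x ^ 2) := by
  have h := integrable_rpow_mul_exp_neg_mul_sq hb hs
  refine (h.norm.add h.comp_neg.norm).mono' (by fun_prop) (Filter.Eventually.of_forall fun x => ?_)
  rw [Real.norm_eq_abs, abs_of_nonneg (by positivity)]
  simp only [Pi.add_apply, norm_mul, neg_sq, Real.norm_eq_abs, Real.abs_exp]
  rw [← add_mul]
  gcongr
  rcases abs_choice x with h | h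
  · rw [h]
    exact (le_abs_self _).trans (le_add_of_nonneg_right (abs_nonneg _))
  · rw [h]
    exact (le_abs_self _).trans (le_add_of_nonneg_left (abs_nonneg _))

theorem gaussianPDFReal_zero_one (x : ℝ) :
    gaussianPDFReal 0 1 x = (√(2 * Real.pi))⁻¹ * Real.exp (-(1 / 2) * x ^ 2) := by
  simp only [gaussianPDFReal, NNReal.coe_one, mul_one, sub_zero]
  ring_nf

theorem gaussianReal_zero_one_eq :
    gaussianReal 0 1 = volume.withDensity fun x => ENNReal.ofReal (gaussianPDFReal 0 1 x) :=
  gaussianReal_of_var_ne_zero 0 one_ne_zero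

theorem integrable_abs_rpow_gaussianReal {s : ℝ} (hs : -1 < s) :
    Integrable (fun x : ℝ => |x| ^ s) (gaussianReal 0 1) := by
  rw [gaussianReal_zero_one_eq, integrable_withDensity_iff_integrable_smul'
    (measurable_gaussianPDFReal 0 1).ennreal_ofReal
    (Filter.Eventually.of_forall fun t => ENNReal.ofReal_lt_top)]
  refine ((integrable_abs_rpow_mul_exp_neg_mul_sq (b := 1 / 2) (by norm_num) hs).const_mul
    (√(2 * Real.pi))⁻¹).congr (Filter.Eventually.of_forall fun x => ?_)
  beta_reduce
  rw [ENNReal.toReal_ofReal (gaussianPDFReal_nonneg 0 1 x), gaussianPDFReal_zero_one, smul_eq_mul]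
  ring

/-- The summand `1` covers `x = 0`, where the logarithm and both powers take the value `0`. The
exponent `-1 / 2` is integrable at the origin. -/
theorem exp_half_abs_log_abs_le (x : ℝ) :
    Real.exp (1 / 2 * |Real.log (|x|)|) ≤ 1 + |x| ^ (1 / 2 : ℝ) + |x| ^ (-(1 / 2) : ℝ) := by
  rcases eq_or_ne x 0 with rfl | hx
  · simp
  · have h : 0 < |x| := abs_pos.2 hx
    rw [Real.rpow_def_of_pos h, Real.rpow_def_of_pos h]
    rcases abs_choice (Real.log |x|) with h | h <;> rw [h]
    · rw [mul_comm]
      linarith [Real.exp_pos (Real.log |x| * (-(1 / 2)))]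
    · rw [show 1 / 2 * -Real.log |x| = Real.log |x| * (-(1 / 2)) by ring]
      linarith [Real.exp_pos (Real.log |x| * (1 / 2))]

theorem integrable_exp_half_abs_log_abs_gaussianReal :
    Integrable (fun x : ℝ => Real.exp (1 / 2 * |Real.log (|x|)|)) (gaussianReal 0 1) := by
  refine (((integrable_const 1).add (integrable_abs_rpow_gaussianReal (s := 1 / 2)
    (by norm_num))).add (integrable_abs_rpow_gaussianReal (s := -(1 / 2)) (by norm_num))).mono'
    (Measurable.aestronglyMeasurable (by fun_prop)) (Filter.Eventually.of_forall fun x => ?_)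
  rw [Real.norm_eq_abs, Real.abs_exp]
  exact exp_half_abs_log_abs_le x

theorem integrable_log_abs_gaussianReal :
    Integrable (fun x : ℝ => Real.log |x|) (gaussianReal 0 1) := by
  refine (integrable_exp_half_abs_log_abs_gaussianReal.const_mul 2).mono'
    (Measurable.aestronglyMeasurable (by fun_prop)) (Filter.Eventually.of_forall fun x => ?_)
  rw [Real.norm_eq_abs]
  linarith [Real.add_one_le_exp (1 / 2 * |Real.log (|x|)|)]

/-- The law of `log |Z| - 𝔼 log |Z|` for a standard real Gaussian `Z`. -/
noncomputable def centredLogAbsGaussian : Measure ℝ :=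
  (gaussianReal 0 1).map fun z => Real.log |z| - meanLogAbsGaussian

theorem measurable_log_abs_sub (a : ℝ) : Measurable fun z : ℝ => Real.log |z| - a := by
  fun_prop

instance isProbabilityMeasure_centredLogAbsGaussian :
    IsProbabilityMeasure centredLogAbsGaussian :=
  Measure.isProbabilityMeasure_map (measurable_log_abs_sub _).aemeasurable

/-- The Gaussian density is positive at `0`, so `|Z| ≤ exp (-t)` has probability of order `exp
(-t)`. The right tail is far lighter, which is why only the left tail is required to be exponential.
-/
theorem hasExponentialTails_centredLogAbsGaussian :
    HasExponentialTails centredLogAbsGaussian := by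
  set a := meanLogAbsGaussian with ha
  have hmeas := measurable_log_abs_sub a
  have hfin : IsFiniteMeasure
      (volume.withDensity fun x : ℝ => ENNReal.ofReal (gaussianPDFReal 0 1 x)) := by
    rw [← gaussianReal_zero_one_eq]
    infer_instance
  have hpdf : ∀ x y : ℝ, |x| ≤ y → gaussianPDFReal 0 1 y ≤ gaussianPDFReal 0 1 x :=
      fun x y hxy => by
    rw [gaussianPDFReal_zero_one, gaussianPDFReal_zero_one]
    have : x ^ 2 ≤ y ^ 2 := sq_le_sq.2 (hxy.trans (le_abs_self y))
    gcongr ?_ * Real.exp ?_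
    linarith
  have hpos := gaussianPDFReal_pos 0 1 2 one_ne_zero
  -- The point `-a` corresponds to `|Z| = 1`. The tails are bounded below by `Z` in `[1, 2]` and in
  -- `[exp (-t) / 2, exp (-t)]`, where the density is at least its value at `2`.
  refine ⟨⟨1 / 2, by norm_num, ?_⟩, ?_, -a, gaussianPDFReal 0 1 2 / 2, by positivity, ?_,
    fun t ht => ?_⟩
  · rw [centredLogAbsGaussian, integrable_map_measure (by fun_prop) hmeas.aemeasurable]
    have hmeas' : Measurable fun x : ℝ => Real.exp (1 / 2 * |Real.log |x| - a|) := by fun_prop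
    refine (integrable_exp_half_abs_log_abs_gaussianReal.const_mul
      (Real.exp (1 / 2 * |a|))).mono' hmeas'.aestronglyMeasurable
      (Filter.Eventually.of_forall fun x => ?_)
    rw [Real.norm_eq_abs, Function.comp, Real.abs_exp, ← Real.exp_add]
    gcongr
    linarith [abs_sub (Real.log |x|) a]
  · rw [centredLogAbsGaussian, integral_map hmeas.aemeasurable (by fun_prop),
      integral_sub integrable_log_abs_gaussianReal (integrable_const _)]
    simp [ha, meanLogAbsGaussian]
  · rw [centredLogAbsGaussian, map_measureReal_apply hmeas measurableSet_Ici,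
      gaussianReal_zero_one_eq]
    refine le_trans (b := gaussianPDFReal 0 1 2 * (2 - 1)) (by linarith)
      (mul_sub_le_withDensity_real hpos.le (fun x hx => hpdf _ _ ?_) fun x hx => ?_)
    · exact abs_le.2 ⟨by linarith [hx.1], hx.2⟩
    · have : 0 ≤ Real.log |x| := Real.log_nonneg (hx.1.trans (le_abs_self x))
      simpa using this
  · rw [centredLogAbsGaussian, map_measureReal_apply hmeas measurableSet_Iic,
      gaussianReal_zero_one_eq]
    have he := Real.exp_pos (-t)
    have he1 : Real.exp (-t) ≤ 1 := Real.exp_le_one_iff.2 (by linarith)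
    refine le_trans (le_of_eq (by ring)) (mul_sub_le_withDensity_real
      (u := Real.exp (-t) / 2) (v := Real.exp (-t)) hpos.le
      (fun x hx => hpdf _ _ ?_) fun x hx => ?_)
    · exact abs_le.2 ⟨by linarith [hx.1], by linarith [hx.2]⟩
    · have hx0 : 0 < x := by linarith [hx.1]
      have h : Real.log |x| ≤ -t := by
        rw [abs_of_pos hx0, Real.log_le_iff_le_exp hx0]
        exact hx.2
      rw [Set.mem_preimage, Set.mem_Iic]
      linarith

/-! ### Head and tail of the rearrangement -/

section Rearrangement

variable {n : ℕ} (x : EuclideanSpace ℝ (Fin n))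

theorem sum_sq_decreasingRearrangement :
    ∑ i, decreasingRearrangement x i ^ 2 = ∑ i, x i ^ 2 := by
  simp only [decreasingRearrangement, sq_abs]
  exact Equiv.sum_comp (Tuple.sort fun j => -|x j|) fun i => x i ^ 2

theorem abs_apply_eq_decreasingRearrangement (i : Fin n) :
    |x i| = decreasingRearrangement x ((Tuple.sort fun j => -|x j|).symm i) := by
  simp [decreasingRearrangement]

theorem decreasingRearrangement_nonneg (i : Fin n) : 0 ≤ decreasingRearrangement x i :=
  abs_nonneg _

theorem supNorm_headPart (hn : 0 < n) {s : ℝ} (hs : 1 ≤ s) :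
    supNorm (headPart x s) = decreasingRearrangement x ⟨0, hn⟩ := by
  have h0 := decreasingRearrangement_nonneg x ⟨0, hn⟩
  refine le_antisymm ((pi_norm_le_iff_of_nonneg h0).2 fun i => ?_) ?_
  · simp only [headPart]
    split_ifs
    · rw [Real.norm_of_nonneg (decreasingRearrangement_nonneg x i)]
      exact decreasingRearrangement_antitone x (Nat.zero_le (i : ℕ))
    · simpa using h0
  · refine le_trans (le_of_eq ?_) (norm_le_pi_norm (WithLp.ofLp (headPart x s)) ⟨0, hn⟩)
    simp [headPart, hs, abs_of_nonneg h0]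

theorem abs_le_supNorm_headPart {s : ℝ} (hs : 1 ≤ s) (i : Fin n) :
    |x i| ≤ supNorm (headPart x s) := by
  rw [supNorm_headPart x i.pos hs, abs_apply_eq_decreasingRearrangement]
  exact decreasingRearrangement_antitone x (Nat.zero_le _)

theorem exists_abs_eq_supNorm_headPart (hn : 0 < n) {s : ℝ} (hs : 1 ≤ s) :
    ∃ i, |x i| = supNorm (headPart x s) :=
  ⟨_, (supNorm_headPart x hn hs).symm⟩

theorem norm_tailPart_sq (s : ℝ) : ‖tailPart x s‖ ^ 2 = ∑ i, tailPart x s i ^ 2 := by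
  simp [EuclideanSpace.norm_sq_eq]

theorem headPart_sq_add_tailPart_sq (s : ℝ) (i : Fin n) :
    headPart x s i ^ 2 + tailPart x s i ^ 2 = decreasingRearrangement x i ^ 2 := by
  simp only [headPart, tailPart]
  split_ifs <;> simp

theorem norm_sq_eq_sum_headPart_add (s : ℝ) :
    ‖x‖ ^ 2 = ∑ i, headPart x s i ^ 2 + ‖tailPart x s‖ ^ 2 := by
  rw [norm_tailPart_sq, ← Finset.sum_add_distrib]
  simp_rw [headPart_sq_add_tailPart_sq]
  rw [sum_sq_decreasingRearrangement]
  simp [EuclideanSpace.norm_sq_eq]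

theorem card_filter_add_one_le {s : ℝ} (hs : 0 ≤ s) :
    ((Finset.univ.filter fun i : Fin n => ((i : ℕ) : ℝ) + 1 ≤ s).card : ℝ) ≤ s := by
  refine le_trans ?_ (Nat.floor_le hs)
  have h := Finset.card_le_card_of_injOn (s := Finset.univ.filter fun i : Fin n =>
    ((i : ℕ) : ℝ) + 1 ≤ s) (t := Finset.range ⌊s⌋₊) (fun i => (i : ℕ)) (fun i hi => by
      have hi' : ((i : ℕ) : ℝ) + 1 ≤ s := by simpa using hi
      have : (i : ℕ) + 1 ≤ ⌊s⌋₊ := Nat.le_floor (by exact_mod_cast hi')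
      simpa using this) (fun i _ j _ h => Fin.ext h)
  rw [Finset.card_range] at h
  exact_mod_cast h

theorem sum_headPart_sq_le {s : ℝ} (hs : 0 ≤ s) :
    ∑ i, headPart x s i ^ 2 ≤ s * supNorm (headPart x s) ^ 2 := by
  classical
  calc ∑ i, headPart x s i ^ 2
      = ∑ i ∈ Finset.univ.filter fun i : Fin n => ((i : ℕ) : ℝ) + 1 ≤ s, headPart x s i ^ 2 := by
        refine (Finset.sum_filter_of_ne fun i _ hi => ?_).symm
        by_contra h
        exact hi (by simp [headPart, h])
    _ ≤ ∑ i ∈ Finset.univ.filter fun i : Fin n => ((i : ℕ) : ℝ) + 1 ≤ s,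
          supNorm (headPart x s) ^ 2 := by
        refine Finset.sum_le_sum fun i _ => sq_le_sq' ?_ ?_
        · exact (abs_le.1 (norm_le_pi_norm (WithLp.ofLp (headPart x s)) i)).1
        · exact (abs_le.1 (norm_le_pi_norm (WithLp.ofLp (headPart x s)) i)).2
    _ ≤ s * supNorm (headPart x s) ^ 2 := by
        rw [Finset.sum_const, nsmul_eq_mul]
        gcongr
        exact card_filter_add_one_le hs

theorem norm_tailPart_le (s : ℝ) : ‖tailPart x s‖ ≤ ‖x‖ := by
  refine (sq_le_sq₀ (norm_nonneg _) (norm_nonneg _)).1 ?_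
  rw [norm_sq_eq_sum_headPart_add x s]
  have : 0 ≤ ∑ i, headPart x s i ^ 2 := by positivity
  linarith

/-- The head has at most `s` nonzero entries, each at most its sup norm. -/
theorem norm_le_sqrt_mul_supNorm_add {s : ℝ} (hs : 0 ≤ s) :
    ‖x‖ ≤ √s * supNorm (headPart x s) + ‖tailPart x s‖ := by
  have h0 : 0 ≤ supNorm (headPart x s) := norm_nonneg _
  refine (sq_le_sq₀ (norm_nonneg _) (by positivity)).1 ?_
  rw [norm_sq_eq_sum_headPart_add x s, add_sq, mul_pow, Real.sq_sqrt hs]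
  have h1 := sum_headPart_sq_le x hs
  have h2 : 0 ≤ 2 * (√s * supNorm (headPart x s)) * ‖tailPart x s‖ := by positivity
  linarith

end Rearrangement

/-! ### Transfer to arbitrary probability spaces and conclusion -/

theorem momentNorm_comp_of_hasLaw {Ω 𝓧 : Type*} [MeasurableSpace Ω] [MeasurableSpace 𝓧]
    {μ : Measure Ω} {ν : Measure 𝓧} {X : Ω → 𝓧} (hX : HasLaw X ν μ) {f : 𝓧 → ℝ}
    (hf : Measurable f) (p : ℝ) : momentNorm μ (fun ω => f (X ω)) p = momentNorm ν f p := by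
  unfold momentNorm
  rw [← hX.integral_comp (f := fun x => |f x| ^ p)
    (hf.abs.pow_const p).aestronglyMeasurable]
  rfl

theorem HasExponentialTails.exists_momentNorm_bounds {ρ : Measure ℝ} [IsProbabilityMeasure ρ]
    (hρ : HasExponentialTails ρ) :
    ∃ C₁ C₂ : ℝ, 0 < C₁ ∧ 0 < C₂ ∧ ∀ (n : ℕ), 1 ≤ n → ∀ (p : ℝ), 1 ≤ p →
      ∀ θ ∈ Metric.sphere (0 : EuclideanSpace ℝ (Fin n)) 1,
      ∀ {Ω : Type*} [MeasurableSpace Ω] (μ : Measure Ω),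
      ∀ X : Fin n → Ω → ℝ, (∀ i, HasLaw (X i) ρ μ) → iIndepFun X μ →
        MemLp (fun ω => ∑ i, θ i * X i ω) (ENNReal.ofReal p) μ ∧
        C₁ * p * supNorm (headPart θ p) + C₁ * √p * ‖tailPart θ p‖
          ≤ momentNorm μ (fun ω => ∑ i, θ i * X i ω) p ∧
        momentNorm μ (fun ω => ∑ i, θ i * X i ω) p
          ≤ C₂ * p * supNorm (headPart θ p) + C₂ * √p * ‖tailPart θ p‖ := by
  obtain ⟨C₁, C₂, hC₁, hC₂, h⟩ := hρ.exists_momentNorm_equiv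
  refine ⟨C₁, 2 * C₂, hC₁, by positivity, fun n hn p hp θ hθ Ω _ μ X hX hind => ?_⟩
  have hθ1 : ‖θ‖ = 1 := by simpa using hθ
  have hp0 : 0 ≤ p := by linarith
  have hsum : ∑ i, θ i ^ 2 = 1 := by
    have := EuclideanSpace.norm_sq_eq θ
    simpa [hθ1] using this.symm
  obtain ⟨hmem, hlow, hup⟩ := h n p hp θ _ hsum (abs_le_supNorm_headPart θ hp)
    (exists_abs_eq_supNorm_headPart θ hn hp)
  have hlaw := hind.hasLaw_pi hX
  have hm := momentNorm_comp_of_hasLaw hlaw (f := fun x : Fin n → ℝ => ∑ i, θ i * x i)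
    (by fun_prop) p
  rw [← hm] at hlow hup
  have h1 := norm_le_sqrt_mul_supNorm_add θ hp0
  have h2 := norm_tailPart_le θ p
  rw [hθ1] at h1 h2
  have h0 : 0 ≤ supNorm (headPart θ p) := norm_nonneg _
  set M := supNorm (headPart θ p)
  set T := ‖tailPart θ p‖
  refine ⟨?_, le_trans ?_ hlow, hup.trans ?_⟩
  · rw [← hlaw.map_eq] at hmem
    exact (memLp_map_measure_iff hmem.1 hlaw.aemeasurable).1 hmem
  · rw [mul_assoc, mul_assoc, ← mul_add]
    gcongr
    exact mul_le_of_le_one_right (Real.sqrt_nonneg p) h2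
  -- Unit norm gives `√p ≤ p * M + √p * T`; the extra `p * M` accounts for doubling `C₂`.
  · have h3 : √p * 1 ≤ √p * (√p * M + T) := by gcongr
    rw [mul_add, ← mul_assoc, Real.mul_self_sqrt hp0, mul_one] at h3
    have h4 : 0 ≤ √p * T := mul_nonneg (Real.sqrt_nonneg p) (norm_nonneg _)
    calc C₂ * (p * M + √p) ≤ C₂ * (2 * (p * M + √p * T)) := by
          gcongr
          linarith
      _ = _ := by ring

theorem mainTheorem5 :
    ∃ C₁ C₂ : ℝ, 0 < C₁ ∧ 0 < C₂ ∧
      ∀ (n : ℕ), 1 ≤ n → ∀ (p : ℝ), 1 ≤ p →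
      ∀ θ ∈ Metric.sphere (0 : EuclideanSpace ℝ (Fin n)) 1,
      ∀ {Ω : Type*} [MeasurableSpace Ω] (μ : Measure Ω) [IsProbabilityMeasure μ],
        (∀ Z : Fin n → Ω → ℝ,
          (∀ i, HasLaw (Z i) (gaussianReal 0 1) μ) → iIndepFun Z μ →
          ∀ W : Fin n → Ω → ℝ,
            (∀ i ω, W i ω = Real.log |Z i ω| - meanLogAbsGaussian) →
            MemLp (fun ω => ∑ i, θ i * W i ω) (ENNReal.ofReal p) μ ∧
            C₁ * p * supNorm (headPart θ p) + C₁ * √p * ‖tailPart θ p‖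
              ≤ momentNorm μ (fun ω => ∑ i, θ i * W i ω) p ∧
            momentNorm μ (fun ω => ∑ i, θ i * W i ω) p
              ≤ C₂ * p * supNorm (headPart θ p) + C₂ * √p * ‖tailPart θ p‖) ∧
        (∀ L : Fin n → Ω → ℝ,
          (∀ i, HasLaw (L i) symmetricExponential μ) → iIndepFun L μ →
            MemLp (fun ω => ∑ i, θ i * L i ω) (ENNReal.ofReal p) μ ∧
            C₁ * p * supNorm (headPart θ p) + C₁ * √p * ‖tailPart θ p‖
              ≤ momentNorm μ (fun ω => ∑ i, θ i * L i ω) p ∧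
            momentNorm μ (fun ω => ∑ i, θ i * L i ω) p
              ≤ C₂ * p * supNorm (headPart θ p) + C₂ * √p * ‖tailPart θ p‖) := by
  obtain ⟨A₁, A₂, hA₁, hA₂, hA⟩ :=
    hasExponentialTails_centredLogAbsGaussian.exists_momentNorm_bounds
  obtain ⟨B₁, B₂, hB₁, hB₂, hB⟩ :=
    hasExponentialTails_symmetricExponential.exists_momentNorm_bounds
  refine ⟨min A₁ B₁, max A₂ B₂, lt_min hA₁ hB₁, lt_max_of_lt_left hA₂,
    fun n hn p hp θ hθ Ω _ μ _ => ⟨fun Z hZ hind W hW => ?_, fun L hL hind => ?_⟩⟩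
  all_goals have h0 : 0 ≤ supNorm (headPart θ p) := norm_nonneg _
  · have hmeas := measurable_log_abs_sub meanLogAbsGaussian
    obtain rfl : W = fun i ω => Real.log |Z i ω| - meanLogAbsGaussian :=
      funext fun i => funext (hW i)
    obtain ⟨h1, h2, h3⟩ := hA n hn p hp θ hθ μ _
      (fun i => HasLaw.fun_comp ⟨hmeas.aemeasurable, rfl⟩ (hZ i))
      (hind.comp (fun _ z => Real.log |z| - meanLogAbsGaussian) fun _ => hmeas)
    refine ⟨h1, le_trans ?_ h2, h3.trans ?_⟩
    · gcongr <;> exact min_le_left _ _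
    · gcongr <;> exact le_max_left _ _
  · obtain ⟨h1, h2, h3⟩ := hB n hn p hp θ hθ μ L hL hind
    refine ⟨h1, le_trans ?_ h2, h3.trans ?_⟩
    · gcongr <;> exact min_le_right _ _
    · gcongr <;> exact le_max_right _ _
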